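/- For each $d\in\mathbb N$ let $\phi_d$ be a probability measure on $\mathbb R^d$ which is even (invariant under $x\mapsto -x$) and assigns measure zero to each hyperplane through the origin $o$. For $N\in\mathbb N$ let $X_1,\dots,X_N$ be independent random vectors in $\mathbb R^d$ with distribution $\phi_d$, and define the Wendel probability $$P_{d,N}:=\mathbb P\left(o\notin \operatorname{conv}\{X_1,\dots,X_N\}\right).$$ Let $\Phi$ denote the distribution function of the standard normal distribution. Let $c$ be a real constant and let $N=N(d)$ be a sequence of nonnegative integers. (a) If $(N-2d)/\sqrt d\to c$ as $d\to\infty$, then $\lim_{d\to\infty}P_{d,N}=\Phi(-c/\sqrt2)\in(0,1)$. (b) If $N-2d\ge c\,d^{\alpha}$ for all sufficiently large $d$, with $\frac12<\alpha<1$ and $c>0$, then $\lim_{d\to\infty}P_{d,N}=0$. (c) If $-c\,d^{\alpha}\le N-2d\le c\,d^{\alpha}$ for all sufficiently large $d$, with $0<\alpha<\frac12$ and $c\ge0$, then $\lim_{d\to\infty}P_{d,N}=\frac12$. (d) If $N-2d\le c\,d^{\alpha}$ for all sufficiently large $d$, with $\frac12<\alpha<1$ and $c<0$, then $\lim_{d\to\infty}P_{d,N}=1$.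 Moreover, for every $\alpha$ with $\frac12<\alpha<1$ one can choose $N=N(d)\ge d+1$, depending only on $d$ and $\alpha$, such that $d/N\to\frac12$, $N-2d=O(d^{\alpha})$ as $d\to\infty$, and, for every choice of the measures $\phi_d$ as above, $$\liminf_{d\to\infty}P_{d,N}=0,\qquad \limsup_{d\to\infty}P_{d,N}=1.$$ -/

import Mathlib

open MeasureTheory ProbabilityTheory Filter Topology

noncomputable section

/-- A probability measure on `ℝ^d` that is even (invariant under `x ↦ -x`) and assigns measure
zero to each hyperplane through the origin. -/
structure IsEvenHyperplaneNull {d : ℕ} (φ : Measure (EuclideanSpace ℝ (Fin d))) : Prop where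
  isProbabilityMeasure : IsProbabilityMeasure φ
  even : φ.map (fun x => -x) = φ
  hyperplane_null : ∀ u : EuclideanSpace ℝ (Fin d), u ≠ 0 → φ {x | inner ℝ u x = 0} = 0

/-- The Wendel probability `P_{d,N} = ℙ(0 ∉ conv {X₁, …, X_N})`, where `X₁, …, X_N` are independent
random vectors in `ℝ^d` with distribution `φ`; their joint law is the product measure `φ^N`. -/
def wendelProb {d : ℕ} (φ : Measure (EuclideanSpace ℝ (Fin d))) (N : ℕ) : ℝ :=
  (Measure.pi (fun _ : Fin N => φ)).real
    {x : Fin N → EuclideanSpace ℝ (Fin d) | 0 ∉ convexHull ℝ (Set.range x)}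

/-- The distribution function `Φ` of the standard normal distribution. -/
def stdNormalCDF (t : ℝ) : ℝ := cdf (gaussianReal 0 1) t

end

/-! Since `φ` is even, random signs do not change the law of the sample, so the Wendel probability
is the mean proportion of the `2 ^ N` sign patterns `ε` for which some `u` has `⟨ε i • x i, u⟩ > 0`
for all `i`. These patterns correspond to the chambers of the hyperplanes orthogonal to the `x i`.
The sample is almost surely in general position, and then deletion and restriction show that their
number depends only on `N` and `d` (`IsGeneralPosition.ncard_realizedSigns`).

Hence `P_{d,N}` is the probability of fewer than `d` heads in `N - 1` fair tosses, whatever `φ` is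
(`IsEvenHyperplaneNull.wendelProb_succ`). For `N` near `2 d` the number of heads fluctuates on the
scale `√d`. Deviations `N - 2 d` of that order or smaller are settled by de Moivre–Laplace, larger
ones by Chebyshev. Alternating between large positive and large negative deviations with the parity
of `d` destroys the limit. -/

/-! ### Chambers of hyperplane arrangements -/

/-- Schläfli's numbers: the number of chambers of `n` hyperplanes through the origin in general
position in dimension `d`, given by their recurrence. -/
def chamberCount : ℕ → ℕ → ℕ
  | 0, _ => 1
  | _ + 1, 0 => 0
  | n + 1, d + 1 => chamberCount n (d + 1) + chamberCount n d

/-- The sign patterns that the functionals `f i` realize at some common point. -/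
def realizedSigns {V : Type*} [AddCommGroup V] [Module ℝ V] {n : ℕ}
    (f : Fin n → Module.Dual ℝ V) : Set (Fin n → ℤˣ) :=
  {ε | ∃ v, ∀ i, 0 < ε i • f i v}

section Chambers

variable {V : Type*} [AddCommGroup V] [Module ℝ V] {n : ℕ}

/-- Strict sign conditions survive a small perturbation. -/
theorem exists_pos_perturbation (f : Fin n → Module.Dual ℝ V) (ε : Fin n → ℤˣ) (v w : V)
    (h : ∀ i, 0 < ε i • f i v) : ∃ t : ℝ, 0 < t ∧ ∀ i, 0 < ε i • f i (v + t • w) := by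
  have key : ∀ᶠ t in 𝓝 (0 : ℝ), ∀ i, 0 < ε i • f i (v + t • w) := by
    refine eventually_all.2 fun i => ?_
    have hc : Continuous fun t : ℝ => ε i • f i (v + t • w) := by
      rcases Int.units_eq_one_or (ε i) with e | e <;> simp only [e, map_add, map_smul, one_smul,
        Units.neg_smul, smul_eq_mul] <;> fun_prop
    have := hc.tendsto 0
    exact this.eventually_const_lt (by simpa using h i)
  obtain ⟨t, h1, h2⟩ := ((key.filter_mono nhdsWithin_le_nhds).and
    (self_mem_nhdsWithin : Set.Ioi (0 : ℝ) ∈ 𝓝[>] 0)).exists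
  exact ⟨t, h2, h1⟩

/-- The sign patterns of `f` realized at a point where `g` has the sign `u`. -/
def realizedSignsOn (f : Fin n → Module.Dual ℝ V) (g : Module.Dual ℝ V) (u : ℤˣ) :
    Set (Fin n → ℤˣ) :=
  {ε | ∃ v, 0 < u • g v ∧ ∀ i, 0 < ε i • f i v}

/-- A point on the hyperplane `g = 0` can be pushed slightly to either side without spoiling the
strict conditions on `f`. -/
theorem exists_realizing_of_apply_eq_zero (f : Fin n → Module.Dual ℝ V) {g : Module.Dual ℝ V}
    (hg : g ≠ 0) (u : ℤˣ) {ε : Fin n → ℤˣ} {v : V} (hv : g v = 0) (h : ∀ i, 0 < ε i • f i v) :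
    ε ∈ realizedSignsOn f g u := by
  obtain ⟨w, hw⟩ : ∃ w, g w ≠ 0 := by
    by_contra! hw
    exact hg (LinearMap.ext hw)
  obtain ⟨t, ht, hf⟩ := exists_pos_perturbation f ε v (u • (g w)⁻¹ • w) h
  refine ⟨_, ?_, hf⟩
  rcases Int.units_eq_one_or u with e | e <;> simp [e, hv, hw, ht]

theorem realizedSignsOn_union (f : Fin n → Module.Dual ℝ V) {g : Module.Dual ℝ V} (hg : g ≠ 0) :
    realizedSignsOn f g 1 ∪ realizedSignsOn f g (-1) = realizedSigns f := by
  ext ε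
  constructor
  · rintro (⟨v, -, h⟩ | ⟨v, -, h⟩) <;> exact ⟨v, h⟩
  · rintro ⟨v, h⟩
    rcases lt_trichotomy (g v) 0 with hv | hv | hv
    · exact Or.inr ⟨v, by simpa using hv, h⟩
    · exact Or.inl (exists_realizing_of_apply_eq_zero f hg 1 hv h)
    · exact Or.inl ⟨v, by simpa using hv, h⟩

/-- The points realizing a given pattern form a convex cone. If it meets both sides of `g = 0`, a
positive combination of one point from each side lies on the hyperplane. -/
theorem realizedSignsOn_inter (f : Fin n → Module.Dual ℝ V) {g : Module.Dual ℝ V} (hg : g ≠ 0) :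
    realizedSignsOn f g 1 ∩ realizedSignsOn f g (-1) =
      realizedSigns fun i => (f i).comp (LinearMap.ker g).subtype := by
  ext ε
  constructor
  · rintro ⟨⟨v, hv, h⟩, ⟨w, hw, h'⟩⟩
    simp only [one_smul, Units.neg_smul, Left.neg_pos_iff] at hv hw
    refine ⟨⟨(-g w) • v + g v • w, by simp; ring⟩, fun i => ?_⟩
    have e : ε i • ((f i).comp (LinearMap.ker g).subtype)
        ⟨(-g w) • v + g v • w, by simp; ring⟩ =
        (-g w) * (ε i • f i v) + g v * (ε i • f i w) := by
      rcases Int.units_eq_one_or (ε i) with e | e <;> simp [e]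
    rw [e]
    have := mul_pos (neg_pos.2 hw) (h i)
    have := mul_pos hv (h' i)
    linarith
  · rintro ⟨⟨v, hv⟩, h⟩
    exact ⟨exists_realizing_of_apply_eq_zero f hg 1 hv h,
      exists_realizing_of_apply_eq_zero f hg (-1) hv h⟩

theorem realizedSigns_succ (f : Fin (n + 1) → Module.Dual ℝ V) :
    realizedSigns f = Fin.cons (1 : ℤˣ) '' realizedSignsOn (Fin.tail f) (f 0) 1 ∪
      Fin.cons (-1 : ℤˣ) '' realizedSignsOn (Fin.tail f) (f 0) (-1) := by
  ext ε
  constructor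
  · rintro ⟨v, h⟩
    have h0 := h 0
    have ht : ∀ i : Fin n, 0 < Fin.tail ε i • Fin.tail f i v := fun i => h i.succ
    rcases Int.units_eq_one_or (ε 0) with e | e
    · exact Or.inl ⟨Fin.tail ε, ⟨v, by rwa [e] at h0, ht⟩, by rw [← e, Fin.cons_self_tail]⟩
    · exact Or.inr ⟨Fin.tail ε, ⟨v, by rwa [e] at h0, ht⟩, by rw [← e, Fin.cons_self_tail]⟩
  · rintro (⟨ε, ⟨v, h0, h⟩, rfl⟩ | ⟨ε, ⟨v, h0, h⟩, rfl⟩) <;>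
      exact ⟨v, Fin.cases (by simpa using h0) fun i => by simpa [Fin.tail] using h i⟩

/-- Deletion and restriction: the two sides of `f 0` contribute `|A| + |B| = |A ∪ B| + |A ∩ B|`,
where the union belongs to the deleted arrangement and the intersection to the restricted one. -/
theorem ncard_realizedSigns_succ (f : Fin (n + 1) → Module.Dual ℝ V) (h0 : f 0 ≠ 0) :
    (realizedSigns f).ncard = (realizedSigns (Fin.tail f)).ncard +
      (realizedSigns fun i => (Fin.tail f i).comp (LinearMap.ker (f 0)).subtype).ncard := by
  rw [← realizedSignsOn_union (Fin.tail f) h0, ← realizedSignsOn_inter (Fin.tail f) h0,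
    Set.ncard_union_add_ncard_inter _ _, realizedSigns_succ, Set.ncard_union_eq,
    Set.ncard_image_of_injective _ (Fin.cons_right_injective _),
    Set.ncard_image_of_injective _ (Fin.cons_right_injective _)]
  rw [Set.disjoint_left]
  rintro _ ⟨ε, -, rfl⟩ ⟨δ, -, h⟩
  have := congrFun h 0
  simp at this

/-- A family is in general position in dimension `d` if every `d` of its members are linearly
independent. -/
def IsGeneralPosition {ι W : Type*} [AddCommGroup W] [Module ℝ W] (d : ℕ) (x : ι → W) : Prop :=
  ∀ s : Finset ι, s.card ≤ d → LinearIndepOn ℝ x (s : Set ι)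

theorem IsGeneralPosition.tail {W : Type*} [AddCommGroup W] [Module ℝ W] {d : ℕ}
    {x : Fin (n + 1) → W} (h : IsGeneralPosition d x) : IsGeneralPosition d (Fin.tail x) := by
  intro s hs
  have := h (s.map (Fin.succEmb n)) (by simpa using hs)
  rw [Finset.coe_map] at this
  exact this.comp_of_image (Fin.succ_injective n).injOn

/-- A combination vanishing on `ker (f 0)` is a multiple of `f 0`, so a relation among `d`
restrictions lifts to a relation among `d + 1` of the original functionals. -/
theorem IsGeneralPosition.restrict_ker {d : ℕ} {f : Fin (n + 1) → Module.Dual ℝ V}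
    (h : IsGeneralPosition (d + 1) f) :
    IsGeneralPosition d fun i => (Fin.tail f i).comp (LinearMap.ker (f 0)).subtype := by
  intro s hs
  rw [linearIndepOn_finset_iff]
  intro a ha i hi
  have hle : ⨅ _ : Unit, LinearMap.ker (f 0) ≤ LinearMap.ker (∑ j ∈ s, a j • Fin.tail f j) := by
    intro v hv
    simp only [ciInf_const] at hv
    have := LinearMap.congr_fun ha ⟨v, hv⟩
    simpa using this
  have hmem := mem_span_of_iInf_ker_le_ker (L := fun _ : Unit => f 0) hle
  rw [Set.range_const, Submodule.mem_span_singleton] at hmem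
  obtain ⟨c, hc⟩ := hmem
  have hi' := h (insert 0 (s.map (Fin.succEmb n))) (by
    rw [Finset.card_insert_of_notMem (by simp), Finset.card_map]
    omega)
  rw [linearIndepOn_finset_iff] at hi'
  have := hi' (Fin.cons (-c) a) (by
    rw [Finset.sum_insert (by simp), Finset.sum_map]
    simp only [Fin.cons_zero, neg_smul, hc, Fin.coe_succEmb, Fin.cons_succ]
    simp [Fin.tail]) i.succ (by simp [hi])
  simpa using this

end Chambers

/-- **Schläfli's formula**, as a recurrence: the number of sign patterns realized by linear
functionals in general position. -/
theorem IsGeneralPosition.ncard_realizedSigns {n : ℕ} : ∀ {V : Type*} [AddCommGroup V] [Module ℝ V]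
    [FiniteDimensional ℝ V] {f : Fin n → Module.Dual ℝ V},
    IsGeneralPosition (Module.finrank ℝ V) f →
      (realizedSigns f).ncard = chamberCount n (Module.finrank ℝ V) := by
  induction n with
  | zero =>
    intro V _ _ _ f _
    have : realizedSigns f = Set.univ := by
      ext ε
      simp [realizedSigns]
    simp [this, chamberCount, Set.ncard_univ]
  | succ n ih =>
    intro V _ _ _ f hf
    rcases Nat.eq_zero_or_pos (Module.finrank ℝ V) with hd | hd
    · have := Module.finrank_zero_iff.1 hd
      have hempty : realizedSigns f = ∅ := by
        ext ε
        simp only [realizedSigns, Set.mem_ofPred_eq, Set.mem_empty_iff_false, iff_false]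
        rintro ⟨v, h⟩
        simpa [Subsingleton.elim v 0] using h 0
      rw [hempty, hd, Set.ncard_empty, chamberCount]
    · obtain ⟨d, hd⟩ := Nat.exists_eq_succ_of_ne_zero hd.ne'
      have h0 : f 0 ≠ 0 := (hf {0} (by simp; omega)).ne_zero (by simp)
      have hker : Module.finrank ℝ (LinearMap.ker (f 0)) = d := by
        have := Module.Dual.finrank_ker_add_one_of_ne_zero h0
        omega
      rw [ncard_realizedSigns_succ f h0, ih hf.tail, ih, hker, hd]
      · rfl
      · rw [hker]
        rw [hd] at hf
        exact hf.restrict_ker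

/-- A set of at most `d` indices that contains `0` leaves fewer than `d` for `y`, so only spans of
fewer than `d` vectors have to be avoided. -/
theorem IsGeneralPosition.cons {W : Type*} [AddCommGroup W] [Module ℝ W] {d n : ℕ} {x : W}
    {y : Fin n → W} (hy : IsGeneralPosition d y)
    (hx : ∀ t : Finset (Fin n), t.card < d → x ∉ Submodule.span ℝ (y '' t)) :
    IsGeneralPosition d (Fin.cons x y : Fin (n + 1) → W) := by
  intro s hs
  set t : Finset (Fin n) := Finset.univ.filter fun i => i.succ ∈ s with ht
  have hts : t.map (Fin.succEmb n) ⊆ s := by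
    intro i
    simp only [ht, Finset.mem_map, Finset.mem_filter, Finset.mem_univ, true_and]
    rintro ⟨j, hj, rfl⟩
    exact hj
  have hst : ∀ i : Fin n, i.succ ∈ s → i.succ ∈ Fin.succ '' (t : Set (Fin n)) := fun i hi =>
    ⟨i, by simpa [ht] using hi, rfl⟩
  have hind : t.card ≤ d →
      LinearIndepOn ℝ (Fin.cons x y : Fin (n + 1) → W) (Fin.succ '' (t : Set (Fin n))) :=
    fun h => LinearIndepOn.image_of_comp Fin.succ _ (hy t h)
  have hcard := Finset.card_le_card hts
  rw [Finset.card_map] at hcard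
  by_cases h0 : (0 : Fin (n + 1)) ∈ s
  · have hlt : t.card < s.card := by
      rw [← Finset.card_map (Fin.succEmb n)]
      refine Finset.card_lt_card ⟨hts, fun h => ?_⟩
      simpa using h h0
    refine ((hind (by omega)).insert (x := 0) ?_).mono ?_
    · rw [Set.image_image]
      simpa using hx t (by omega)
    · intro i
      refine Fin.cases (fun _ => Set.mem_insert _ _) (fun j hj => ?_) i
      exact Set.mem_insert_of_mem _ (hst j hj)
  · refine (hind (by omega)).mono ?_
    intro i
    refine Fin.cases (fun h => absurd h h0) (fun j hj => hst j hj) i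

theorem isOpen_isGeneralPosition {W : Type*} [NormedAddCommGroup W] [NormedSpace ℝ W] (d n : ℕ) :
    IsOpen {x : Fin n → W | IsGeneralPosition d x} := by
  have : {x : Fin n → W | IsGeneralPosition d x} =
      ⋂ s : Finset (Fin n), ⋂ _ : s.card ≤ d,
        (fun x : Fin n → W => fun i : (s : Set (Fin n)) => x i) ⁻¹'
          {f | LinearIndependent ℝ f} := by
    ext x
    simp [IsGeneralPosition, LinearIndepOn]
  rw [this]
  refine isOpen_iInter_of_finite fun s => isOpen_iInter_of_finite fun _ => ?_
  exact isOpen_setOfPred_linearIndependent.preimage (by fun_prop)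

/-! ### Wendel's theorem -/

section Wendel

variable {d : ℕ} {φ : Measure (EuclideanSpace ℝ (Fin d))}

theorem IsEvenHyperplaneNull.measure_span_eq_zero (h : IsEvenHyperplaneNull φ) {n : ℕ}
    (y : Fin n → EuclideanSpace ℝ (Fin d)) (t : Finset (Fin n)) (ht : t.card < d) :
    φ (Submodule.span ℝ (y '' t) : Set (EuclideanSpace ℝ (Fin d))) = 0 := by
  classical
  set K := Submodule.span ℝ (y '' (t : Set (Fin n))) with hK
  have hne : K ≠ ⊤ := by
    intro htop
    have h1 : Module.finrank ℝ K ≤ (t.image y).card := by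
      rw [hK, ← Finset.coe_image]
      exact finrank_span_finset_le_card _
    have h2 := Finset.card_image_le (s := t) (f := y)
    rw [htop, finrank_top, finrank_euclideanSpace_fin] at h1
    omega
  -- Fewer than `d` vectors span a proper subspace, which lies in a hyperplane `u^⊥`.
  obtain ⟨u, hu, hu0⟩ := (Submodule.ne_bot_iff _).1 (mt Submodule.orthogonal_eq_bot_iff.1 hne)
  refine measure_mono_null (fun x hx => ?_) (h.hyperplane_null u hu0)
  exact Submodule.inner_left_of_mem_orthogonal hx hu

theorem IsEvenHyperplaneNull.ae_isGeneralPosition (h : IsEvenHyperplaneNull φ) (n : ℕ) :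
    ∀ᵐ x ∂Measure.pi (fun _ : Fin n => φ), IsGeneralPosition d x := by
  have := h.isProbabilityMeasure
  induction n with
  | zero =>
    refine ae_of_all _ fun x s _ => ?_
    rw [Finset.eq_empty_of_isEmpty s, Finset.coe_empty]
    exact linearIndepOn_empty ℝ x
  | succ n ih =>
    have hmp := (measurePreserving_piFinSuccAbove
      (fun _ : Fin (n + 1) => φ) 0).symm (MeasurableEquiv.piFinSuccAbove _ 0)
    rw [← hmp.map_eq, ae_map_iff hmp.aemeasurable
      (isOpen_isGeneralPosition d (n + 1)).measurableSet]
    have hcons : ∀ z : EuclideanSpace ℝ (Fin d) × (Fin n → EuclideanSpace ℝ (Fin d)),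
        (MeasurableEquiv.piFinSuccAbove (fun _ : Fin (n + 1) => EuclideanSpace ℝ (Fin d)) 0).symm z
          = Fin.cons z.1 z.2 := by
      intro z
      simp [MeasurableEquiv.piFinSuccAbove, Fin.insertNthEquiv]
    simp only [hcons]
    have hmeas : MeasurableSet {z : EuclideanSpace ℝ (Fin d) × (Fin n → EuclideanSpace ℝ (Fin d)) |
        IsGeneralPosition d (Fin.cons z.1 z.2 : Fin (n + 1) → EuclideanSpace ℝ (Fin d))} := by
      have := hmp.measurable (isOpen_isGeneralPosition d (n + 1)).measurableSet
      simpa only [Set.preimage_ofPred_eq, hcons] using this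
    -- Fubini, with the order exchanged: `y` is fixed first, and the new vector has only finitely
    -- many null subspaces to avoid.
    rw [Measure.ae_prod_iff_ae_ae hmeas, Measure.ae_ae_comm hmeas]
    filter_upwards [ih] with y hy
    have : ∀ᵐ x ∂φ, ∀ t : Finset (Fin n), t.card < d → x ∉ Submodule.span ℝ (y '' t) := by
      refine ae_all_iff.2 fun t => ?_
      by_cases ht : t.card < d
      · have := measure_eq_zero_iff_ae_notMem.1 (h.measure_span_eq_zero y t ht)
        filter_upwards [this] with x hx _ using hx
      · exact ae_of_all _ fun x hx => absurd hx ht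
    filter_upwards [this] with x hx using hy.cons hx

/-- The origin lies outside the convex hull of finitely many points if and only if the points lie
in a common open half-space bounded by a hyperplane through the origin. -/
theorem zero_notMem_convexHull_range_iff {ι : Type*} [Finite ι]
    (x : ι → EuclideanSpace ℝ (Fin d)) :
    0 ∉ convexHull ℝ (Set.range x) ↔ ∃ u : EuclideanSpace ℝ (Fin d), ∀ i, 0 < inner ℝ (x i) u := by
  constructor
  · intro h
    obtain ⟨f, c, h0, hf⟩ := geometric_hahn_banach_point_closed (convex_convexHull ℝ _)
      ((Set.finite_range x).isClosed_convexHull ℝ) h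
    refine ⟨(InnerProductSpace.toDual ℝ _).symm f, fun i => ?_⟩
    rw [real_inner_comm, InnerProductSpace.toDual_symm_apply]
    rw [map_zero] at h0
    exact h0.trans (hf _ (subset_convexHull ℝ _ ⟨i, rfl⟩))
  · rintro ⟨u, hu⟩ h
    have hsub : convexHull ℝ (Set.range x) ⊆ {y | 0 < innerₗ _ u y} := by
      refine convexHull_min ?_ (convex_halfSpace_gt (innerₗ _ u).isLinear 0)
      rintro _ ⟨i, rfl⟩
      simpa [real_inner_comm] using hu i
    simpa using hsub h

theorem isOpen_zero_notMem_convexHull_range (d n : ℕ) :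
    IsOpen {x : Fin n → EuclideanSpace ℝ (Fin d) | 0 ∉ convexHull ℝ (Set.range x)} := by
  simp only [zero_notMem_convexHull_range_iff, Set.ofPred_exists, Set.ofPred_forall]
  exact isOpen_iUnion fun u => isOpen_iInter_of_finite fun i =>
    isOpen_lt continuous_const (by fun_prop)

theorem IsEvenHyperplaneNull.measurePreserving_units_smul (h : IsEvenHyperplaneNull φ) {n : ℕ}
    (ε : Fin n → ℤˣ) :
    MeasurePreserving (fun (x : Fin n → EuclideanSpace ℝ (Fin d)) i => ε i • x i)
      (Measure.pi fun _ => φ) (Measure.pi fun _ => φ) := by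
  have := h.isProbabilityMeasure
  refine measurePreserving_pi _ _ fun i => ?_
  rcases Int.units_eq_one_or (ε i) with e | e
  · have : (fun x : EuclideanSpace ℝ (Fin d) => ε i • x) = id := by ext1; simp [e]
    exact (congrArg (MeasurePreserving · φ φ) this).mpr (MeasurePreserving.id φ)
  · have : (fun x : EuclideanSpace ℝ (Fin d) => ε i • x) = fun x => -x := by ext1; simp [e]
    exact (congrArg (MeasurePreserving · φ φ) this).mpr ⟨measurable_neg, h.even⟩

/-- By separation, the admissible `ε` are the patterns realized by the functionals `⟨x i, ·⟩`, which
inherit general position because `innerₗ` is injective. -/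
theorem IsGeneralPosition.ncard_signs {n : ℕ} {x : Fin n → EuclideanSpace ℝ (Fin d)}
    (hx : IsGeneralPosition d x) :
    {ε : Fin n → ℤˣ | 0 ∉ convexHull ℝ (Set.range fun i => ε i • x i)}.ncard =
      chamberCount n d := by
  have hf : IsGeneralPosition (Module.finrank ℝ (EuclideanSpace ℝ (Fin d)))
      fun i => innerₗ (EuclideanSpace ℝ (Fin d)) (x i) := by
    rw [finrank_euclideanSpace_fin]
    intro s hs
    refine LinearIndependent.map' (hx s hs) (innerₗ (EuclideanSpace ℝ (Fin d))) ?_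
    rw [LinearMap.ker_eq_bot']
    intro v hv
    have := LinearMap.congr_fun hv v
    simpa using this
  have := hf.ncard_realizedSigns
  rw [finrank_euclideanSpace_fin] at this
  rw [← this]
  congr 1
  ext ε
  simp only [Set.mem_ofPred_eq, zero_notMem_convexHull_range_iff, realizedSigns]
  refine exists_congr fun u => forall_congr' fun i => ?_
  rcases Int.units_eq_one_or (ε i) with e | e <;> simp [e]

/-- **Wendel's theorem.** -/
theorem IsEvenHyperplaneNull.wendelProb_eq (h : IsEvenHyperplaneNull φ) (n : ℕ) :
    wendelProb φ n = chamberCount n d / 2 ^ n := by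
  classical
  have := h.isProbabilityMeasure
  set π := Measure.pi fun _ : Fin n => φ with hπ
  set A := {x : Fin n → EuclideanSpace ℝ (Fin d) | 0 ∉ convexHull ℝ (Set.range x)} with hA
  have hAm : MeasurableSet A := (isOpen_zero_notMem_convexHull_range d n).measurableSet
  -- Double counting: the sum is the integral of the number of admissible patterns, which is almost
  -- surely constant. By evenness its `2 ^ n` terms are equal (`hpre`).
  have hsum : ∑ ε : Fin n → ℤˣ, π ((fun x i => ε i • x i) ⁻¹' A) = chamberCount n d := by
    have hm : ∀ ε : Fin n → ℤˣ, MeasurableSet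
        ((fun (x : Fin n → EuclideanSpace ℝ (Fin d)) i => ε i • x i) ⁻¹' A) :=
      fun ε => (h.measurePreserving_units_smul ε).measurable hAm
    simp_rw [← lintegral_indicator_one (hm _)]
    rw [← lintegral_finsetSum _ fun ε _ => measurable_one.indicator (hm ε)]
    have hae : ∀ᵐ x ∂π, ∑ ε : Fin n → ℤˣ, ((fun (x : Fin n → EuclideanSpace ℝ (Fin d)) i =>
        ε i • x i) ⁻¹' A).indicator (1 : (Fin n → EuclideanSpace ℝ (Fin d)) → ENNReal) x = chamberCount n d := by
      filter_upwards [h.ae_isGeneralPosition n] with x hx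
      rw [← hx.ncard_signs, Set.ncard_eq_toFinset_card']
      simp only [Set.indicator_apply, Set.mem_preimage, Pi.one_apply, Finset.sum_boole, hA,
        Set.mem_ofPred_eq, Set.toFinset_ofPred]
    rw [lintegral_congr_ae hae]
    simp
  have hpre : ∀ ε : Fin n → ℤˣ, π ((fun x i => ε i • x i) ⁻¹' A) = π A := fun ε =>
    (h.measurePreserving_units_smul ε).measure_preimage hAm.nullMeasurableSet
  simp only [hpre] at hsum
  rw [Finset.sum_const, Finset.card_univ, Fintype.card_fun, Fintype.card_units_int,
    Fintype.card_fin, nsmul_eq_mul] at hsum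
  have hreal := congrArg ENNReal.toReal hsum
  rw [ENNReal.toReal_mul] at hreal
  rw [eq_div_iff (by positivity), mul_comm]
  simpa [wendelProb, Measure.real] using hreal

end Wendel

/-! ### Binomial tails and Chebyshev bounds -/

/-- Pascal's rule turns the recurrence into partial row sums; `n + 1` points correspond to `n`
tosses. -/
theorem chamberCount_succ (n d : ℕ) :
    chamberCount (n + 1) d = 2 * ∑ i ∈ Finset.range d, n.choose i := by
  induction n generalizing d with
  | zero =>
    cases d with
    | zero => rfl
    | succ d =>
      rw [Finset.sum_range_succ']
      simp [chamberCount]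
  | succ n ih =>
    cases d with
    | zero => rfl
    | succ d =>
      rw [chamberCount, ih, ih, Finset.sum_range_succ', Finset.sum_range_succ' (n + 1).choose]
      simp only [Nat.choose_succ_succ, Finset.sum_add_distrib, Nat.choose_zero_right]
      ring

theorem IsEvenHyperplaneNull.wendelProb_succ {d : ℕ} {φ : Measure (EuclideanSpace ℝ (Fin d))}
    (h : IsEvenHyperplaneNull φ) (n : ℕ) :
    wendelProb φ (n + 1) = ∑ i ∈ Finset.range d, (n.choose i : ℝ) / 2 ^ n := by
  rw [h.wendelProb_eq, chamberCount_succ, ← Finset.sum_div, pow_succ]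
  push_cast
  field_simp

theorem IsEvenHyperplaneNull.wendelProb_zero {d : ℕ} {φ : Measure (EuclideanSpace ℝ (Fin d))}
    (h : IsEvenHyperplaneNull φ) : wendelProb φ 0 = 1 := by
  simp [h.wendelProb_eq, chamberCount]

theorem sum_choose_div_two_pow (n : ℕ) :
    ∑ i ∈ Finset.range (n + 1), (n.choose i : ℝ) / 2 ^ n = 1 := by
  rw [← Finset.sum_div, div_eq_one_iff_eq (by positivity)]
  exact_mod_cast Nat.sum_range_choose n

theorem sum_sq_mul_choose_div_two_pow (n : ℕ) :
    ∑ i ∈ Finset.range (n + 1), (2 * (i : ℝ) - n) ^ 2 * ((n.choose i : ℝ) / 2 ^ n) = (n : ℝ) := by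
  -- The variance identity for Bernstein polynomials at `1 / 2` is the variance of a fair binomial;
  -- the factor `4` comes from `2 i - n` replacing `i - n / 2`.
  have h := congrArg (Polynomial.eval (1 / 2 : ℝ)) (bernsteinPolynomial.variance ℝ n)
  simp only [Polynomial.eval_finsetSum, bernsteinPolynomial, Polynomial.eval_mul,
    Polynomial.eval_pow, Polynomial.eval_sub, Polynomial.eval_X, Polynomial.eval_natCast,
    Polynomial.eval_one, nsmul_eq_mul] at h
  have h4 : 4 * ((n : ℝ) * (1 / 2) * (1 - 1 / 2)) = n := by ring
  refine Eq.trans ?_ h4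
  rw [← h, Finset.mul_sum]
  refine Finset.sum_congr rfl fun i hi => ?_
  have hp : (1 / 2 : ℝ) ^ i * (1 - 1 / 2) ^ (n - i) = 1 / 2 ^ n := by
    rw [show (1 - 1 / 2 : ℝ) = 1 / 2 by norm_num, ← pow_add,
      Nat.add_sub_cancel' (Nat.lt_succ_iff.1 (Finset.mem_range.1 hi)), one_div_pow]
  rw [mul_assoc (n.choose i : ℝ), hp]
  ring

/-- Chebyshev's inequality for the binomial distribution with parameter `1 / 2`. -/
theorem sum_filter_choose_div_two_pow_le (n : ℕ) (p : ℕ → Prop) [DecidablePred p] {m : ℝ}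
    (hm : 0 < m) (hp : ∀ i, p i → m ^ 2 ≤ (2 * (i : ℝ) - n) ^ 2) :
    ∑ i ∈ Finset.range (n + 1) with p i, (n.choose i : ℝ) / 2 ^ n ≤ n / m ^ 2 := by
  rw [le_div_iff₀ (by positivity), Finset.sum_mul]
  refine le_trans ?_ (sum_sq_mul_choose_div_two_pow n).le
  calc ∑ i ∈ Finset.range (n + 1) with p i, (n.choose i : ℝ) / 2 ^ n * m ^ 2
      ≤ ∑ i ∈ Finset.range (n + 1) with p i, (2 * (i : ℝ) - n) ^ 2 * ((n.choose i : ℝ) / 2 ^ n) := by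
        refine Finset.sum_le_sum fun i hi => ?_
        rw [mul_comm]
        exact mul_le_mul_of_nonneg_right (hp i (Finset.mem_filter.1 hi).2) (by positivity)
    _ ≤ _ := Finset.sum_le_sum_of_subset_of_nonneg (Finset.filter_subset _ _)
        fun i _ _ => by positivity

theorem sum_range_choose_eq_filter (n d : ℕ) :
    ∑ i ∈ Finset.range d, (n.choose i : ℝ) / 2 ^ n =
      ∑ i ∈ Finset.range (n + 1) with i < d, (n.choose i : ℝ) / 2 ^ n := by
  symm
  refine Finset.sum_subset (fun i => by simp) fun i hi hi' => ?_
  have : n < i := by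
    simp only [Finset.mem_filter, Finset.mem_range, not_and] at hi hi'
    by_contra! hc
    exact hi' (by omega) hi
  simp [Nat.choose_eq_zero_of_lt this]

theorem IsEvenHyperplaneNull.wendelProb_le {d : ℕ} {φ : Measure (EuclideanSpace ℝ (Fin d))}
    (h : IsEvenHyperplaneNull φ) {N : ℕ} (hN : 2 * d < N) :
    wendelProb φ N ≤ N / ((N : ℝ) - 2 * d) ^ 2 := by
  obtain ⟨n, rfl⟩ := Nat.exists_eq_succ_of_ne_zero (show N ≠ 0 by omega)
  have hm : (0 : ℝ) < (n.succ : ℝ) - 2 * d := by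
    rw [sub_pos]
    exact_mod_cast hN
  rw [Nat.succ_eq_add_one, h.wendelProb_succ, sum_range_choose_eq_filter]
  -- With `N = n + 1`, `i ≤ d - 1` gives `n - 2 i ≥ N - 2 d + 1`, so the threshold `N - 2 d` is
  -- safe.
  refine (sum_filter_choose_div_two_pow_le n _ hm fun i hi => ?_).trans ?_
  · rw [← sq_abs (2 * (i : ℝ) - n)]
    refine pow_le_pow_left₀ hm.le (le_trans ?_ (neg_le_abs _)) 2
    have : (i : ℝ) + 1 ≤ d := by exact_mod_cast hi
    push_cast
    linarith
  · gcongr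
    simp

theorem IsEvenHyperplaneNull.one_sub_le_wendelProb {d : ℕ}
    {φ : Measure (EuclideanSpace ℝ (Fin d))}
    (h : IsEvenHyperplaneNull φ) {N : ℕ} (hN : N < 2 * d) :
    1 - N / (2 * d - (N : ℝ)) ^ 2 ≤ wendelProb φ N := by
  have hm : (0 : ℝ) < 2 * d - (N : ℝ) := by
    rw [sub_pos]
    exact_mod_cast hN
  cases N with
  | zero => simp [h.wendelProb_zero]
  | succ n =>
    rw [h.wendelProb_succ, sum_range_choose_eq_filter]
    have hsplit := Finset.sum_filter_add_sum_filter_not (Finset.range (n + 1)) (· < d)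
      fun i => (n.choose i : ℝ) / 2 ^ n
    rw [sum_choose_div_two_pow] at hsplit
    have hle := sum_filter_choose_div_two_pow_le n (fun i => ¬ i < d) hm fun i hi => by
      rw [← sq_abs (2 * (i : ℝ) - n)]
      refine pow_le_pow_left₀ hm.le (le_trans ?_ (le_abs_self _)) 2
      have : (d : ℝ) ≤ i := by exact_mod_cast not_lt.1 hi
      push_cast
      linarith
    have : (n : ℝ) / (2 * d - ((n + 1 : ℕ) : ℝ)) ^ 2 ≤
        ((n + 1 : ℕ) : ℝ) / (2 * d - ((n + 1 : ℕ) : ℝ)) ^ 2 := by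
      gcongr
      simp
    linarith

/-! ### De Moivre–Laplace and the normal distribution function -/

/-- The law of the standardized number of heads in `n` tosses of a fair coin. -/
noncomputable def coinTossLaw (n : ℕ) : Measure ℝ :=
  ∑ i ∈ Finset.range (n + 1),
    ENNReal.ofReal ((n.choose i : ℝ) / 2 ^ n) • Measure.dirac ((2 * (i : ℝ) - n) / √n)

instance (n : ℕ) : IsProbabilityMeasure (coinTossLaw n) where
  measure_univ := by
    simp only [coinTossLaw, Measure.coe_finsetSum, Finset.sum_apply, Measure.smul_apply,
      measure_univ, smul_eq_mul, mul_one]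
    rw [← ENNReal.ofReal_sum_of_nonneg fun i _ => by positivity, sum_choose_div_two_pow,
      ENNReal.ofReal_one]

theorem coinTossLaw_real_Iic (n : ℕ) (t : ℝ) :
    (coinTossLaw n).real (Set.Iic t) =
      ∑ i ∈ Finset.range (n + 1) with (2 * ((i : ℕ) : ℝ) - n) / √n ≤ t, (n.choose i : ℝ) / 2 ^ n := by
  have : (coinTossLaw n) (Set.Iic t) = ∑ i ∈ Finset.range (n + 1),
      ENNReal.ofReal (if (2 * ((i : ℕ) : ℝ) - n) / √n ≤ t then (n.choose i : ℝ) / 2 ^ n else 0) := by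
    simp only [coinTossLaw, Measure.coe_finsetSum, Finset.sum_apply, Measure.smul_apply,
      smul_eq_mul]
    refine Finset.sum_congr rfl fun i _ => ?_
    rw [Measure.dirac_apply' _ measurableSet_Iic]
    split_ifs with h <;> simp [h]
  rw [Measure.real, this, ← ENNReal.ofReal_sum_of_nonneg fun i _ => by positivity,
    ENNReal.toReal_ofReal (Finset.sum_nonneg fun i _ => by positivity), Finset.sum_filter]

/-- The binomial expansion of `((e^{is} + e^{-is}) / 2) ^ n` with `s = t / √n`. -/
theorem charFun_coinTossLaw (n : ℕ) (t : ℝ) :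
    charFun (coinTossLaw n) t = ((Real.cos (t / √n) ^ n : ℝ) : ℂ) := by
  rw [charFun_apply_real, coinTossLaw, integral_finsetSum_measure]
  · push_cast
    rw [Complex.cos, div_pow, add_pow, Finset.sum_div]
    refine Finset.sum_congr rfl fun i hi => ?_
    rw [integral_smul_measure, integral_dirac, ENNReal.toReal_ofReal (by positivity),
      ← Complex.exp_nat_mul, ← Complex.exp_nat_mul, ← Complex.exp_add,
      Nat.cast_sub (Nat.lt_succ_iff.1 (Finset.mem_range.1 hi)), Complex.real_smul]
    push_cast
    rw [mul_comm, mul_div_assoc]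
    congr 2
    ring
  · intro i _
    refine Integrable.smul_measure ?_ ENNReal.ofReal_ne_top
    exact integrable_dirac (by simp)

theorem tendsto_cos_div_sqrt_pow (t : ℝ) :
    Tendsto (fun n : ℕ => Real.cos (t / √n) ^ n) atTop (𝓝 (Real.exp (-(t ^ 2 / 2)))) := by
  -- Taylor expansion of the cosine; `5 / 96` is the constant of `Real.cos_bound`.
  have key : Tendsto (fun n : ℕ => (n : ℝ) * (Real.cos (t / √n) - 1)) atTop
      (𝓝 (-(t ^ 2 / 2))) := by
    rw [tendsto_iff_norm_sub_tendsto_zero]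
    have hz : Tendsto (fun n : ℕ => t ^ 4 * (5 / 96) / (n : ℝ)) atTop (𝓝 0) :=
      tendsto_const_nhds.div_atTop tendsto_natCast_atTop_atTop
    refine squeeze_zero' (Eventually.of_forall fun _ => norm_nonneg _) ?_ hz
    have hs : Tendsto (fun n : ℕ => t / √(n : ℝ)) atTop (𝓝 0) :=
      tendsto_const_nhds.div_atTop (Real.tendsto_sqrt_atTop.comp tendsto_natCast_atTop_atTop)
    have h1 : ∀ᶠ n : ℕ in atTop, |t / √(n : ℝ)| < 1 := by
      have := hs.abs
      rw [abs_zero] at this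
      exact this.eventually_lt_const one_pos
    filter_upwards [h1, eventually_gt_atTop 0] with n hn hn0
    have hn0' : (0 : ℝ) < n := by exact_mod_cast hn0
    have hsq : √(n : ℝ) ^ 2 = n := Real.sq_sqrt hn0'.le
    have hb := Real.cos_bound hn.le
    have e1 : (n : ℝ) * (Real.cos (t / √n) - 1) - -(t ^ 2 / 2) =
        n * (Real.cos (t / √n) - (1 - (t / √n) ^ 2 / 2)) := by
      rw [div_pow, hsq]
      field_simp
      ring
    have e2 : |t / √(n : ℝ)| ^ 4 = t ^ 4 / (n : ℝ) ^ 2 := by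
      rw [pow_abs, abs_of_nonneg (by positivity), div_pow,
        show √(n : ℝ) ^ 4 = (√(n : ℝ) ^ 2) ^ 2 by ring, hsq]
    rw [e1, Real.norm_eq_abs, abs_mul, abs_of_pos hn0']
    calc (n : ℝ) * |Real.cos (t / √n) - (1 - (t / √n) ^ 2 / 2)|
        ≤ n * (|t / √(n : ℝ)| ^ 4 * (5 / 96)) := by gcongr
      _ = t ^ 4 * (5 / 96) / n := by
        rw [e2]
        field_simp
  simpa using Real.tendsto_one_add_pow_exp_of_tendsto key

/-- The **de Moivre–Laplace theorem**, as weak convergence. -/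
theorem tendsto_coinTossLaw :
    Tendsto (β := ProbabilityMeasure ℝ) (fun n => ⟨coinTossLaw n, inferInstance⟩) atTop
      (𝓝 ⟨gaussianReal 0 1, inferInstance⟩) := by
  refine ProbabilityMeasure.tendsto_iff_tendsto_charFun.2 fun t => ?_
  have h := (Complex.continuous_ofReal.tendsto _).comp (tendsto_cos_div_sqrt_pow t)
  have e : charFun (gaussianReal 0 1) t = ((Real.exp (-(t ^ 2 / 2)) : ℝ) : ℂ) := by
    rw [charFun_gaussianReal]
    push_cast
    congr 1
    simp
  simp only [ProbabilityMeasure.coe_mk, charFun_coinTossLaw, e]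
  exact h

theorem tendsto_coinTossLaw_real_Iic (t : ℝ) :
    Tendsto (fun n => (coinTossLaw n).real (Set.Iic t)) atTop (𝓝 (stdNormalCDF t)) := by
  have := nullSingletonClass_gaussianReal (μ := 0) (v := 1) one_ne_zero
  have h := ProbabilityMeasure.tendsto_measure_of_null_frontier_of_tendsto' tendsto_coinTossLaw
    (E := Set.Iic t) (by simp)
  rw [stdNormalCDF, cdf_eq_real]
  exact (ENNReal.tendsto_toReal (measure_ne_top _ _)).comp h

theorem continuous_stdNormalCDF : Continuous stdNormalCDF := by
  have := nullSingletonClass_gaussianReal (μ := 0) (v := 1) one_ne_zero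
  rw [continuous_iff_continuousAt]
  intro t
  have hmono : Monotone (cdf (gaussianReal 0 1)) := monotone_cdf _
  refine hmono.continuousAt_iff_leftLim_eq_rightLim.2 ?_
  rw [StieltjesFunction.rightLim_eq]
  have h := (cdf (gaussianReal 0 1)).measure_singleton t
  rw [measure_cdf, measure_singleton] at h
  exact le_antisymm (hmono.leftLim_le le_rfl) (sub_nonpos.1 (ENNReal.ofReal_eq_zero.1 h.symm))

theorem stdNormalCDF_mem_Ioo (t : ℝ) : stdNormalCDF t ∈ Set.Ioo (0 : ℝ) 1 := by
  have hpos : ∀ s : Set ℝ, IsOpen s → s.Nonempty → 0 < (gaussianReal 0 1).real s := by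
    intro s hs hne
    rw [measureReal_def, ENNReal.toReal_pos_iff]
    refine ⟨pos_iff_ne_zero.2 fun h0 => ?_, measure_lt_top _ _⟩
    exact (hs.measure_pos volume hne).ne'
      (gaussianReal_absolutelyContinuous' 0 one_ne_zero h0)
  rw [stdNormalCDF, cdf_eq_real]
  constructor
  · exact (hpos _ isOpen_Iio Set.nonempty_Iio).trans_le (measureReal_mono Set.Iio_subset_Iic_self)
  · have := hpos _ isOpen_Ioi (Set.nonempty_Ioi (a := t))
    rw [← Set.compl_Iic, probReal_compl_eq_one_sub measurableSet_Iic] at this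
    linarith

theorem stdNormalCDF_zero : stdNormalCDF 0 = 1 / 2 := by
  have := nullSingletonClass_gaussianReal (μ := 0) (v := 1) one_ne_zero
  have h1 : (gaussianReal 0 1).real (Set.Iic 0) = (gaussianReal 0 1).real (Set.Ici 0) := by
    have h := gaussianReal_map_neg (μ := 0) (v := 1)
    rw [neg_zero] at h
    conv_lhs => rw [← h]
    rw [map_measureReal_apply measurable_neg measurableSet_Iic]
    simp
  have h2 : (gaussianReal 0 1).real (Set.Ici 0) = (gaussianReal 0 1).real (Set.Ioi 0) :=
    measureReal_congr Ioi_ae_eq_Ici.symm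
  have h3 : (gaussianReal 0 1).real (Set.Ioi (0 : ℝ)) = 1 - (gaussianReal 0 1).real (Set.Iic 0) := by
    rw [← Set.compl_Iic, probReal_compl_eq_one_sub measurableSet_Iic]
  rw [stdNormalCDF, cdf_eq_real]
  linarith

/-- Monotonicity in the threshold compares `τ i` with a fixed `s` near `t`, and continuity of the
limit lets `s` be close enough; no uniform convergence is needed. -/
theorem tendsto_coinTossLaw_real_Iic_of_tendsto {ι : Type*} {l : Filter ι} {n : ι → ℕ} {τ : ι → ℝ}
    {t : ℝ} (hn : Tendsto n l atTop) (hτ : Tendsto τ l (𝓝 t)) :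
    Tendsto (fun i => (coinTossLaw (n i)).real (Set.Iic (τ i))) l (𝓝 (stdNormalCDF t)) := by
  rw [tendsto_order]
  constructor
  · intro a ha
    obtain ⟨s, hs, hst⟩ : ∃ s, a < stdNormalCDF s ∧ s < t :=
      (((continuous_stdNormalCDF.tendsto t).eventually_const_lt ha).filter_mono
        nhdsWithin_le_nhds |>.and (self_mem_nhdsWithin : Set.Iio t ∈ 𝓝[<] t)).exists
    filter_upwards [hτ.eventually_const_lt hst,
      ((tendsto_coinTossLaw_real_Iic s).comp hn).eventually_const_lt hs] with i h1 h2
    exact h2.trans_le (measureReal_mono (Set.Iic_subset_Iic.2 h1.le))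
  · intro a ha
    obtain ⟨s, hs, hst⟩ : ∃ s, stdNormalCDF s < a ∧ t < s :=
      (((continuous_stdNormalCDF.tendsto t).eventually_lt_const ha).filter_mono
        nhdsWithin_le_nhds |>.and (self_mem_nhdsWithin : Set.Ioi t ∈ 𝓝[>] t)).exists
    filter_upwards [hτ.eventually_lt_const hst,
      ((tendsto_coinTossLaw_real_Iic s).comp hn).eventually_lt_const hs] with i h1 h2
    exact (measureReal_mono (Set.Iic_subset_Iic.2 h1.le)).trans_lt h2

/-- For integers, `i < d` means `2 i ≤ 2 d - 1`, which makes the threshold exactly `(2 d - N) / √(N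
- 1)` with `N = n + 1`. -/
theorem IsEvenHyperplaneNull.wendelProb_eq_coinTossLaw {d : ℕ}
    {φ : Measure (EuclideanSpace ℝ (Fin d))} (h : IsEvenHyperplaneNull φ) {n : ℕ} (hn : 0 < n) :
    wendelProb φ (n + 1) =
      (coinTossLaw n).real (Set.Iic ((2 * (d : ℝ) - ((n + 1 : ℕ) : ℝ)) / √n)) := by
  rw [h.wendelProb_succ, sum_range_choose_eq_filter, coinTossLaw_real_Iic]
  refine Finset.sum_congr (Finset.filter_congr fun i _ => ?_) fun _ _ => rfl
  have : (0 : ℝ) < √n := Real.sqrt_pos.2 (by exact_mod_cast hn)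
  rw [div_le_div_iff_of_pos_right this]
  push_cast
  constructor
  · intro hi
    have : (i : ℝ) + 1 ≤ d := by exact_mod_cast hi
    linarith
  · intro hi
    have : 2 * (i : ℝ) < 2 * d := by linarith
    exact_mod_cast (mul_lt_mul_iff_right₀ (by norm_num : (0 : ℝ) < 2)).1 this

/-! ### The asymptotic regimes -/

theorem tendsto_natCast_rpow_atTop_zero {s : ℝ} (hs : s < 0) :
    Tendsto (fun d : ℕ => (d : ℝ) ^ s) atTop (𝓝 0) := by
  have := (tendsto_rpow_neg_atTop (neg_pos.2 hs)).comp tendsto_natCast_atTop_atTop (α := ℕ)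
  rw [neg_neg] at this
  exact this

theorem isLittleO_natCast_rpow {α : ℝ} (hα : α < 1) :
    (fun d : ℕ => (d : ℝ) ^ α) =o[atTop] fun d : ℕ => (d : ℝ) := by
  refine (Asymptotics.isLittleO_iff_tendsto' ?_).2
    ((tendsto_natCast_rpow_atTop_zero (sub_neg.2 hα)).congr' ?_)
  all_goals
    filter_upwards [eventually_gt_atTop 0] with d hd
    have hd' : (0 : ℝ) < d := by exact_mod_cast hd
  · exact fun h => absurd h hd'.ne'
  · rw [Real.rpow_sub hd', Real.rpow_one]

theorem IsEvenHyperplaneNull.wendelProb_mem_Icc {d : ℕ}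
    {φ : Measure (EuclideanSpace ℝ (Fin d))} (h : IsEvenHyperplaneNull φ) (N : ℕ) :
    wendelProb φ N ∈ Set.Icc (0 : ℝ) 1 := by
  have := h.isProbabilityMeasure
  exact ⟨measureReal_nonneg, measureReal_le_one⟩

section Asymptotics

variable {φ : (d : ℕ) → Measure (EuclideanSpace ℝ (Fin d))} {N : ℕ → ℕ}

theorem tendsto_wendelProb_normal (hφ : ∀ d, IsEvenHyperplaneNull (φ d)) {c : ℝ}
    (hN : Tendsto (fun d : ℕ => ((N d : ℝ) - 2 * (d : ℝ)) / √(d : ℝ)) atTop (𝓝 c)) :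
    Tendsto (fun d : ℕ => wendelProb (φ d) (N d)) atTop (𝓝 (stdNormalCDF (-c / √2))) := by
  have hsqrt : Tendsto (fun d : ℕ => √(d : ℝ)) atTop atTop :=
    Real.tendsto_sqrt_atTop.comp tendsto_natCast_atTop_atTop
  have hratio : Tendsto (fun d : ℕ => ((N d : ℝ) - 1) / d) atTop (𝓝 2) := by
    have h1 : Tendsto (fun d : ℕ => (1 : ℝ) / (d : ℝ)) atTop (𝓝 0) :=
      tendsto_const_nhds.div_atTop tendsto_natCast_atTop_atTop
    have h2 := ((hN.div_atTop hsqrt).const_add 2).sub h1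
    rw [add_zero, sub_zero] at h2
    refine h2.congr' ?_
    filter_upwards [eventually_gt_atTop 0] with d hd
    have hd' : (0 : ℝ) < d := by exact_mod_cast hd
    rw [div_div, Real.mul_self_sqrt hd'.le]
    field_simp
    ring
  have hlarge : ∀ᶠ d in atTop, d + 1 < N d := by
    filter_upwards [hratio.eventually_const_lt one_lt_two, eventually_gt_atTop 0] with d hd hd0
    rw [one_lt_div (by exact_mod_cast hd0)] at hd
    have : (d : ℝ) + 1 < N d := by linarith
    exact_mod_cast this
  have hn : Tendsto (fun d => N d - 1) atTop atTop := by
    refine tendsto_atTop_mono' atTop ?_ tendsto_id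
    filter_upwards [hlarge] with d hd
    simp only [id]
    omega
  -- Since `N - 1 ~ 2 d`, normalizing by `√(N - 1)` instead of `√d` costs a factor `√2`.
  have hτ : Tendsto (fun d : ℕ => (2 * (d : ℝ) - N d) / √((N d - 1 : ℕ) : ℝ)) atTop
      (𝓝 (-c / √2)) := by
    refine (hN.neg.div hratio.sqrt (by positivity)).congr' ?_
    filter_upwards [hlarge, eventually_gt_atTop 0] with d hd hd0
    have hd' : (0 : ℝ) < √(d : ℝ) := Real.sqrt_pos.2 (by exact_mod_cast hd0)
    rw [Pi.div_apply, Real.sqrt_div' _ (Nat.cast_nonneg d), Nat.cast_sub (by omega),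
      Nat.cast_one]
    rw [← neg_div, div_div_div_cancel_right₀ hd'.ne', neg_sub]
  refine (tendsto_coinTossLaw_real_Iic_of_tendsto hn hτ).congr' ?_
  filter_upwards [hlarge] with d hd
  have := (hφ d).wendelProb_eq_coinTossLaw (n := N d - 1) (by omega)
  rw [Nat.sub_add_cancel (by omega)] at this
  exact this.symm

theorem tendsto_wendelProb_zero (hφ : ∀ d, IsEvenHyperplaneNull (φ d)) {c α : ℝ}
    (hα : 1 / 2 < α) (hc : 0 < c)
    (hN : ∀ᶠ d : ℕ in atTop, c * (d : ℝ) ^ α ≤ (N d : ℝ) - 2 * (d : ℝ)) :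
    Tendsto (fun d : ℕ => wendelProb (φ d) (N d)) atTop (𝓝 0) := by
  have hlim : Tendsto (fun d : ℕ => c⁻¹ * (d : ℝ) ^ (-α) + 2 / c ^ 2 * (d : ℝ) ^ (1 - 2 * α))
      atTop (𝓝 0) := by
    simpa using ((tendsto_natCast_rpow_atTop_zero (by linarith)).const_mul c⁻¹).add
      ((tendsto_natCast_rpow_atTop_zero (by linarith : 1 - 2 * α < 0)).const_mul (2 / c ^ 2))
  refine squeeze_zero' (Eventually.of_forall fun d => ((hφ d).wendelProb_mem_Icc _).1) ?_ hlim
  filter_upwards [hN, eventually_gt_atTop 0] with d hd hd0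
  have hd' : (0 : ℝ) < d := by exact_mod_cast hd0
  have hpow : (0 : ℝ) < (d : ℝ) ^ α := Real.rpow_pos_of_pos hd' α
  have hm : 0 < (N d : ℝ) - 2 * d := (mul_pos hc hpow).trans_le hd
  have hlt : 2 * d < N d := by exact_mod_cast sub_pos.1 hm
  refine ((hφ d).wendelProb_le hlt).trans ?_
  -- Written this way, the bound is visibly decreasing in `N - 2 d`, which can be replaced by its
  -- lower bound `c d ^ α`.
  have e1 : (N d : ℝ) / ((N d : ℝ) - 2 * d) ^ 2 =
      1 / ((N d : ℝ) - 2 * d) + 2 * d / ((N d : ℝ) - 2 * d) ^ 2 := by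
    field_simp
    ring
  have e2 : c⁻¹ * (d : ℝ) ^ (-α) + 2 / c ^ 2 * (d : ℝ) ^ (1 - 2 * α) =
      1 / (c * (d : ℝ) ^ α) + 2 * d / (c * (d : ℝ) ^ α) ^ 2 := by
    rw [Real.rpow_neg hd'.le, Real.rpow_sub hd', Real.rpow_one, mul_comm 2 α,
      Real.rpow_mul hd'.le, Real.rpow_two]
    field_simp
  rw [e1, e2]
  gcongr

theorem tendsto_wendelProb_one (hφ : ∀ d, IsEvenHyperplaneNull (φ d)) {c α : ℝ}
    (hα : 1 / 2 < α) (hc : c < 0)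
    (hN : ∀ᶠ d : ℕ in atTop, (N d : ℝ) - 2 * (d : ℝ) ≤ c * (d : ℝ) ^ α) :
    Tendsto (fun d : ℕ => wendelProb (φ d) (N d)) atTop (𝓝 1) := by
  have hlim : Tendsto (fun d : ℕ => 1 - 2 / c ^ 2 * (d : ℝ) ^ (1 - 2 * α)) atTop (𝓝 1) := by
    simpa using ((tendsto_natCast_rpow_atTop_zero
      (by linarith : 1 - 2 * α < 0)).const_mul (2 / c ^ 2)).const_sub 1
  refine tendsto_of_tendsto_of_tendsto_of_le_of_le' hlim tendsto_const_nhds ?_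
    (Eventually.of_forall fun d => ((hφ d).wendelProb_mem_Icc _).2)
  filter_upwards [hN, eventually_gt_atTop 0] with d hd hd0
  have hd' : (0 : ℝ) < d := by exact_mod_cast hd0
  have hpow : (0 : ℝ) < (d : ℝ) ^ α := Real.rpow_pos_of_pos hd' α
  have hcp : 0 < -c * (d : ℝ) ^ α := mul_pos (neg_pos.2 hc) hpow
  have hm : -c * (d : ℝ) ^ α ≤ 2 * d - (N d : ℝ) := by linarith
  have hlt : (N d : ℝ) < 2 * d := by linarith
  refine le_trans ?_ ((hφ d).one_sub_le_wendelProb (by exact_mod_cast hlt))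
  have e2 : 2 / c ^ 2 * (d : ℝ) ^ (1 - 2 * α) = 2 * d / (-c * (d : ℝ) ^ α) ^ 2 := by
    rw [Real.rpow_sub hd', Real.rpow_one, mul_comm 2 α, Real.rpow_mul hd'.le, Real.rpow_two]
    field_simp
  rw [e2]
  gcongr

theorem tendsto_wendelProb_half (hφ : ∀ d, IsEvenHyperplaneNull (φ d)) {c α : ℝ}
    (hα : α < 1 / 2)
    (hN : ∀ᶠ d : ℕ in atTop, -c * (d : ℝ) ^ α ≤ (N d : ℝ) - 2 * (d : ℝ) ∧
      (N d : ℝ) - 2 * (d : ℝ) ≤ c * (d : ℝ) ^ α) :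
    Tendsto (fun d : ℕ => wendelProb (φ d) (N d)) atTop (𝓝 (1 / 2)) := by
  -- A deviation of order `d ^ α` with `α < 1 / 2` is negligible against `√d`: this is the normal
  -- regime with limit `0`.
  have h0 : Tendsto (fun d : ℕ => ((N d : ℝ) - 2 * (d : ℝ)) / √(d : ℝ)) atTop (𝓝 0) := by
    have hlim : Tendsto (fun d : ℕ => c * (d : ℝ) ^ (α - 1 / 2)) atTop (𝓝 0) := by
      simpa using (tendsto_natCast_rpow_atTop_zero
        (by linarith : α - 1 / 2 < 0)).const_mul c
    refine squeeze_zero_norm' ?_ hlim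
    filter_upwards [hN, eventually_gt_atTop 0] with d hd hd0
    have hd' : (0 : ℝ) < d := by exact_mod_cast hd0
    rw [Real.rpow_sub hd', ← Real.sqrt_eq_rpow, norm_div, Real.norm_eq_abs, Real.norm_eq_abs,
      abs_of_nonneg (Real.sqrt_nonneg _), ← mul_div_assoc]
    gcongr
    exact abs_le.2 ⟨by linarith [hd.1], hd.2⟩
  have := tendsto_wendelProb_normal hφ h0
  rwa [neg_zero, zero_div, stdNormalCDF_zero] at this

end Asymptotics

/-! ### A sequence without a limit -/

/-- A sequence oscillating between `2 d + d ^ α` and `2 d - d ^ α`. -/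
noncomputable def oscillatingSize (α : ℝ) (d : ℕ) : ℕ :=
  -- The `+ 1` of the even branch serves `d = 0`; the `max` enforces `d + 1 ≤ N` for odd `d` and is
  -- inactive for large `d`.
  if Even d then 2 * d + 1 + ⌈(d : ℝ) ^ α⌉₊ else max (d + 1) (2 * d - ⌈(d : ℝ) ^ α⌉₊)

theorem succ_le_oscillatingSize (α : ℝ) (d : ℕ) : d + 1 ≤ oscillatingSize α d := by
  unfold oscillatingSize
  split_ifs
  · omega
  · exact le_max_left _ _

theorem abs_oscillatingSize_sub_le (α : ℝ) (d : ℕ) :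
    |(oscillatingSize α d : ℝ) - 2 * d| ≤ (d : ℝ) ^ α + 2 := by
  have hceil := (Nat.ceil_lt_add_one (Real.rpow_nonneg (Nat.cast_nonneg d) α)).le
  have hnonneg := Real.rpow_nonneg (Nat.cast_nonneg (α := ℝ) d) α
  have h1 : oscillatingSize α d ≤ 2 * d + 1 + ⌈(d : ℝ) ^ α⌉₊ := by
    unfold oscillatingSize
    split_ifs <;> omega
  have h2 : 2 * d ≤ oscillatingSize α d + ⌈(d : ℝ) ^ α⌉₊ := by
    unfold oscillatingSize
    split_ifs <;> omega
  have h1' : (oscillatingSize α d : ℝ) ≤ 2 * d + 1 + (⌈(d : ℝ) ^ α⌉₊ : ℝ) := by exact_mod_cast h1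
  have h2' : 2 * (d : ℝ) ≤ oscillatingSize α d + (⌈(d : ℝ) ^ α⌉₊ : ℝ) := by exact_mod_cast h2
  exact abs_le.2 ⟨by linarith, by linarith⟩

theorem oscillatingSize_sub_isBigO {α : ℝ} (hα : 0 ≤ α) :
    (fun d : ℕ => (oscillatingSize α d : ℝ) - 2 * (d : ℝ)) =O[atTop]
      fun d : ℕ => (d : ℝ) ^ α := by
  refine Asymptotics.IsBigO.of_bound 3 ?_
  filter_upwards [eventually_ge_atTop 1] with d hd
  have h1 := Real.one_le_rpow (by exact_mod_cast hd : (1 : ℝ) ≤ d) hα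
  rw [Real.norm_eq_abs, Real.norm_of_nonneg (by positivity)]
  linarith [abs_oscillatingSize_sub_le α d]

theorem tendsto_div_oscillatingSize {α : ℝ} (hα : 0 ≤ α) (hα1 : α < 1) :
    Tendsto (fun d : ℕ => (d : ℝ) / (oscillatingSize α d : ℝ)) atTop (𝓝 (1 / 2)) := by
  have hlittle : (fun d : ℕ => (oscillatingSize α d : ℝ) - 2 * (d : ℝ)) =o[atTop]
      fun d : ℕ => (d : ℝ) := by
    exact (oscillatingSize_sub_isBigO hα).trans_isLittleO (isLittleO_natCast_rpow hα1)
  have h := (hlittle.tendsto_div_nhds_zero.const_add 2).inv₀ (by norm_num)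
  rw [add_zero, ← one_div] at h
  refine h.congr' ?_
  filter_upwards [eventually_gt_atTop 0] with d hd
  have hd' : (d : ℝ) ≠ 0 := by exact_mod_cast hd.ne'
  rw [sub_div, mul_div_cancel_right₀ _ hd', add_sub_cancel, inv_div]

theorem liminf_limsup_wendelProb_oscillatingSize {α : ℝ} (hα : 1 / 2 < α) (hα1 : α < 1)
    {φ : (d : ℕ) → Measure (EuclideanSpace ℝ (Fin d))} (hφ : ∀ d, IsEvenHyperplaneNull (φ d)) :
    liminf (fun d : ℕ => wendelProb (φ d) (oscillatingSize α d)) atTop = 0 ∧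
      limsup (fun d : ℕ => wendelProb (φ d) (oscillatingSize α d)) atTop = 1 := by
  set P := fun d : ℕ => wendelProb (φ d) (oscillatingSize α d) with hP
  have h0 : ∀ d, 0 ≤ P d := fun d => ((hφ d).wendelProb_mem_Icc _).1
  have h1 : ∀ d, P d ≤ 1 := fun d => ((hφ d).wendelProb_mem_Icc _).2
  have hbb : IsBoundedUnder (· ≥ ·) atTop P := isBoundedUnder_of ⟨0, h0⟩
  have hba : IsBoundedUnder (· ≤ ·) atTop P := isBoundedUnder_of ⟨1, h1⟩
  have heven : Tendsto (fun d : ℕ => wendelProb (φ d) (2 * d + 1 + ⌈(d : ℝ) ^ α⌉₊)) atTop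
      (𝓝 0) := by
    refine tendsto_wendelProb_zero (N := fun d => 2 * d + 1 + ⌈(d : ℝ) ^ α⌉₊) hφ hα one_pos
      (Eventually.of_forall fun d => ?_)
    have := Nat.le_ceil ((d : ℝ) ^ α)
    push_cast
    linarith
  have hodd : Tendsto (fun d : ℕ => wendelProb (φ d) (max (d + 1) (2 * d - ⌈(d : ℝ) ^ α⌉₊)))
      atTop (𝓝 1) := by
    refine tendsto_wendelProb_one (N := fun d => max (d + 1) (2 * d - ⌈(d : ℝ) ^ α⌉₊)) hφ hα
      (neg_lt_zero.2 one_pos) ?_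
    -- With `d ^ α ≤ d / 4` and `d ≥ 4`, the subtraction is not truncated and both arguments of the
    -- `max` are at most `2 d - d ^ α`.
    filter_upwards [(isLittleO_natCast_rpow hα1).bound (by norm_num : (0 : ℝ) < 1 / 4),
      eventually_ge_atTop 4] with d hd hd4
    rw [Real.norm_of_nonneg (by positivity), Real.norm_of_nonneg (by positivity)] at hd
    have hceil := Nat.le_ceil ((d : ℝ) ^ α)
    have hceil' := Nat.ceil_lt_add_one (Real.rpow_nonneg (Nat.cast_nonneg d) α)
    have hd4' : (4 : ℝ) ≤ d := by exact_mod_cast hd4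
    have hle : ⌈(d : ℝ) ^ α⌉₊ ≤ 2 * d := by
      have : (⌈(d : ℝ) ^ α⌉₊ : ℝ) ≤ 2 * d := by linarith
      exact_mod_cast this
    rw [Nat.cast_max, Nat.cast_sub hle]
    push_cast
    rw [sub_le_iff_le_add]
    refine max_le ?_ ?_ <;> linarith
  constructor
  · refine le_antisymm (le_of_forall_pos_le_add fun ε hε => ?_)
      (le_liminf_of_le hba.isCoboundedUnder_ge (Eventually.of_forall h0))
    refine liminf_le_of_frequently_le ?_ hbb
    have hf : ∃ᶠ d : ℕ in atTop, Even d := Nat.frequently_even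
    refine (hf.and_eventually (heven.eventually_lt_const hε)).mono ?_
    rintro d ⟨hd, hlt⟩
    rw [zero_add]
    simpa [hP, oscillatingSize, hd] using hlt.le
  · refine le_antisymm (limsup_le_of_le hbb.isCoboundedUnder_le (Eventually.of_forall h1))
      (le_of_forall_sub_le fun ε hε => ?_)
    refine le_limsup_of_frequently_le ?_ hba
    have hf : ∃ᶠ d : ℕ in atTop, Odd d := Nat.frequently_odd
    refine (hf.and_eventually (hodd.eventually_const_lt (sub_lt_self 1 hε))).mono ?_
    rintro d ⟨hd, hlt⟩
    simpa only [hP, oscillatingSize, Nat.not_even_iff_odd.2 hd, if_false] using hlt.le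

theorem propositionT2p2 :
    (∀ φ : (d : ℕ) → Measure (EuclideanSpace ℝ (Fin d)), (∀ d, IsEvenHyperplaneNull (φ d)) →
      ∀ (N : ℕ → ℕ) (c : ℝ),
        -- (a)
        (Tendsto (fun d : ℕ => ((N d : ℝ) - 2 * (d : ℝ)) / √(d : ℝ)) atTop (𝓝 c) →
          Tendsto (fun d : ℕ => wendelProb (φ d) (N d)) atTop (𝓝 (stdNormalCDF (-c / √2))) ∧
            stdNormalCDF (-c / √2) ∈ Set.Ioo (0 : ℝ) 1) ∧
        -- (b)
        (∀ α : ℝ, 1 / 2 < α → α < 1 → 0 < c →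
          (∀ᶠ d : ℕ in atTop, c * (d : ℝ) ^ α ≤ (N d : ℝ) - 2 * (d : ℝ)) →
          Tendsto (fun d : ℕ => wendelProb (φ d) (N d)) atTop (𝓝 0)) ∧
        -- (c)
        (∀ α : ℝ, 0 < α → α < 1 / 2 → 0 ≤ c →
          (∀ᶠ d : ℕ in atTop, -c * (d : ℝ) ^ α ≤ (N d : ℝ) - 2 * (d : ℝ) ∧
            (N d : ℝ) - 2 * (d : ℝ) ≤ c * (d : ℝ) ^ α) →
          Tendsto (fun d : ℕ => wendelProb (φ d) (N d)) atTop (𝓝 (1 / 2))) ∧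
        -- (d)
        (∀ α : ℝ, 1 / 2 < α → α < 1 → c < 0 →
          (∀ᶠ d : ℕ in atTop, (N d : ℝ) - 2 * (d : ℝ) ≤ c * (d : ℝ) ^ α) →
          Tendsto (fun d : ℕ => wendelProb (φ d) (N d)) atTop (𝓝 1))) ∧
    -- the choice of `N` with no limit; `N` depends on `α` only
    (∀ α : ℝ, 1 / 2 < α → α < 1 → ∃ N : ℕ → ℕ,
      (∀ d, d + 1 ≤ N d) ∧
      Tendsto (fun d : ℕ => (d : ℝ) / (N d : ℝ)) atTop (𝓝 (1 / 2)) ∧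
      (fun d : ℕ => (N d : ℝ) - 2 * (d : ℝ)) =O[atTop] (fun d : ℕ => (d : ℝ) ^ α) ∧
      ∀ φ : (d : ℕ) → Measure (EuclideanSpace ℝ (Fin d)), (∀ d, IsEvenHyperplaneNull (φ d)) →
        liminf (fun d : ℕ => wendelProb (φ d) (N d)) atTop = 0 ∧
          limsup (fun d : ℕ => wendelProb (φ d) (N d)) atTop = 1) := by
  refine ⟨fun φ hφ N c => ⟨fun h => ⟨tendsto_wendelProb_normal hφ h, stdNormalCDF_mem_Ioo _⟩,
    fun α hα _ hc h => tendsto_wendelProb_zero hφ hα hc h,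
    fun α _ hα _ h => tendsto_wendelProb_half hφ hα h,
    fun α hα _ hc h => tendsto_wendelProb_one hφ hα hc h⟩, fun α hα hα1 => ?_⟩
  have hα0 : 0 ≤ α := by linarith
  exact ⟨oscillatingSize α, succ_le_oscillatingSize α, tendsto_div_oscillatingSize hα0 hα1,
    oscillatingSize_sub_isBigO hα0,
    fun φ hφ => liminf_limsup_wendelProb_oscillatingSize hα hα1 hφ⟩
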